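/- Let $K$ be an algebraically closed field of characteristic $p>0$, let $F=K((t))$ with its $t$-adic valuation $v$ (so $v(t)=1$), let $\mathcal O=K[[t]]$ be its valuation ring, and let $\overline F$ be an algebraic closure of $F$; denote again by $v$ the unique extension of $v$ to $\overline F$. Let $q=p^n$ with $n\ge 1$, let $P\in\mathcal O[[x]]$ be an arbitrary power series, let $a_0,a_1,a_q,a_{q+1}\in\mathcal O$, and put $$Q=x^{q+2}P(x)+a_{q+1}x^{q+1}+a_qx^q+a_1x+a_0\in\mathcal O[[x]].$$ Assume that $v(a_0)=v(a_1)=1$, $v(a_q)=0$ and $v(a_1a_q-a_0a_{q+1})=1$, and that every root of $Q$ in the open unit disk $D=\{x\in\overline F: v(x)>0\}$ is separable over $F$. Then $Q$ has exactly $q$ roots in $D$. Moreover, let $H$ be the image of the homomorphism from $\operatorname{Gal}(\overline F/F)$ to the group of permutations of these $q$ roots given by the Galois action. Then $H$ equals $\operatorname{AGL}_1(q)$ in its action on the affine line; that is, there is a bijection from the set of roots to $\mathbb F_q$ carrying $H$ onto the group of all permutations $x\mapsto ax+b$ of $\mathbb F_q$ with $a\in\mathbb F_q^\times$, $b\in\mathbb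 F_q$. -/

import Mathlib

open scoped LaurentSeries

/-- `Valuation.RankOne` structure on the `t`-adic valuation of `K((t))` (whose value group is
written multiplicatively, `v(t) = exp (-1)`), normalised so that `|t| = 1/2`. -/
@[reducible]
noncomputable def laurentRankOne (K : Type*) [Field K] :
    (Valued.v : Valuation K⸨X⸩ (WithZero (Multiplicative ℤ))).RankOne where
  hom' := (WithZeroMulInt.toNNReal (e := 2) two_ne_zero).comp
    (MonoidWithZeroHom.ValueGroup₀.embedding)
  strictMono' := (WithZeroMulInt.toNNReal_strictMono (e := 2) one_lt_two).comp
    MonoidWithZeroHom.ValueGroup₀.embedding_strictMono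
  exists_val_nontrivial := ⟨HahnSeries.single 1 1, by
    have h := LaurentSeries.valuation_single_zpow K 1
    rw [h]
    exact ⟨by simp, by rw [← WithZero.exp_zero]; simp⟩⟩

/-- The complete normed field `K((t))`, with the absolute value `|f| = 2 ^ (-v f)`, `v` the
`t`-adic valuation. -/
@[reducible]
noncomputable def laurentNormedField (K : Type*) [Field K] : NormedField K⸨X⸩ :=
  letI := laurentRankOne K
  Valued.toNormedField K⸨X⸩ (WithZero (Multiplicative ℤ))

/-- The unique extension to the algebraic closure of `K((t))` of the absolute value
`2 ^ (-v)` of `K((t))`. Thus `v x > 0` means that `laurentAbs K x < 1`. -/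
noncomputable def laurentAbs (K : Type*) [Field K] (x : AlgebraicClosure K⸨X⸩) : ℝ :=
  letI := laurentNormedField K
  spectralNorm K⸨X⸩ (AlgebraicClosure K⸨X⸩) x

/-- The value at `x` of the `n`-th partial sum `∑_{k < n} Q_k x ^ k` of a power series `Q` with
coefficients in `K[[t]]`. -/
noncomputable def laurentPartialSum {K : Type*} [Field K] (Q : PowerSeries (PowerSeries K))
    (x : AlgebraicClosure K⸨X⸩) (n : ℕ) : AlgebraicClosure K⸨X⸩ :=
  ∑ k ∈ Finset.range n,
    algebraMap K⸨X⸩ (AlgebraicClosure K⸨X⸩)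
      (algebraMap (PowerSeries K) K⸨X⸩ (PowerSeries.coeff k Q)) * x ^ k

/-- The roots of `Q` in the open unit disk `{x : v x > 0}` of the algebraic closure of `K((t))`:
the points of the disk at which the partial sums of `Q` converge to `0`. They form a subset that
is stable under the Galois group. -/
noncomputable def diskRoots {K : Type*} [Field K] (Q : PowerSeries (PowerSeries K)) :
    SubMulAction Gal(AlgebraicClosure K⸨X⸩/K⸨X⸩) (AlgebraicClosure K⸨X⸩) where
  carrier := {x | laurentAbs K x < 1 ∧
    Filter.Tendsto (fun n => laurentAbs K (laurentPartialSum Q x n)) Filter.atTop (nhds 0)}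
  smul_mem' := by
    intro σ x hx
    have hσ : ∀ y, laurentAbs K (σ y) = laurentAbs K y := fun y => by
      let := laurentNormedField K
      exact (spectralNorm_eq_of_equiv (K := K⸨X⸩) (L := AlgebraicClosure K⸨X⸩) σ y).symm
    have hs : ∀ n, laurentPartialSum Q (σ • x) n = σ (laurentPartialSum Q x n) := fun n => by
      simp [laurentPartialSum, AlgEquiv.smul_def]
    refine ⟨?_, ?_⟩
    · rw [AlgEquiv.smul_def, hσ]
      exact hx.1
    · simp only [hs, hσ]
      exact hx.2

/-- The homomorphism from the absolute Galois group of `K((t))` to the group of permutations of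
the roots of `Q` in the open unit disk. -/
noncomputable def galPermDiskRoots {K : Type*} [Field K] (Q : PowerSeries (PowerSeries K)) :
    Gal(AlgebraicClosure K⸨X⸩/K⸨X⸩) →* Equiv.Perm (diskRoots Q) :=
  MulAction.toPermHom _ _

/-- The group `AGL₁(k)` of all maps `x ↦ a x + b`, `a ≠ 0`, as a group of permutations of the
affine line over `k`. -/
def AGLOne (k : Type*) [Field k] : Subgroup (Equiv.Perm k) where
  carrier := {σ | ∃ a b : k, a ≠ 0 ∧ ∀ x, σ x = a * x + b}
  one_mem' := ⟨1, 0, one_ne_zero, by simp⟩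
  mul_mem' := by
    rintro σ τ ⟨a, b, ha, h⟩ ⟨c, d, hc, h'⟩
    exact ⟨a * c, a * d + b, mul_ne_zero ha hc, fun x => by
      rw [Equiv.Perm.mul_apply, h', h]; ring⟩
  inv_mem' := by
    rintro σ ⟨a, b, ha, h⟩
    refine ⟨a⁻¹, -(a⁻¹ * b), inv_ne_zero ha, fun x => ?_⟩
    rw [Equiv.Perm.inv_eq_iff_eq, h]
    field_simp
    ring

/-! Weierstrass factorization writes `Q = f * U` with `U` a unit and `f` Eisenstein of degree `q`;
so the roots in the disk are the roots of `f`, they are conjugate, and separability makes them `q`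
in number. Subtracting `Q(x) = 0` from `Q(y) = 0` and dividing by `d = y - x` shows that `d ^ (q -
1)` agrees to leading order with `c = -(a₁ a_q - a₀ a_{q+1}) / a_q ^ 2`, of valuation 1
(`IsAffineSeries.val_sub_pow_sub_lt`). Fix a root `α` and `δ` with `δ ^ (q - 1) = c`: the residue of
`(x - α) / δ` then identifies the roots with `𝔽_q`. Since `σ δ / δ` lies in `𝔽_q`, Galois acts by
affine maps. The image `H` is everything by counting: `α` has `q` conjugates and `δ` has `q - 1`, so
`q (q - 1)` divides `|H|` (`exists_equiv_map_range_eq_AGLOne`). -/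

open scoped NNReal

/-! ### The absolute value on the algebraic closure of `K((t))`. -/

/-- The spectral norm on an algebraic extension of a complete nonarchimedean field, as a
valuation. -/
noncomputable def spectralValuation (F L : Type*) [NontriviallyNormedField F]
    [IsUltrametricDist F] [CompleteSpace F] [Field L] [Algebra F L] [Algebra.IsAlgebraic F L] :
    Valuation L ℝ≥0 where
  toFun x := ⟨spectralNorm F L x, spectralNorm_nonneg x⟩
  map_zero' := NNReal.eq spectralNorm_zero
  map_one' := NNReal.eq spectralNorm_one
  map_mul' x y := NNReal.eq (spectralAlgNorm_mul x y)
  map_add_le_max' x y := isNonarchimedean_spectralNorm x y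

/-- The nontrivially normed field structure underlying `laurentNormedField`. -/
@[reducible]
noncomputable def laurentNontriviallyNormedField (K : Type*) [Field K] :
    NontriviallyNormedField K⸨X⸩ :=
  letI := laurentRankOne K
  Valued.toNontriviallyNormedField K⸨X⸩ (WithZero (Multiplicative ℤ))

theorem laurent_isUltrametricDist (K : Type*) [Field K] :
    letI := laurentNontriviallyNormedField K
    IsUltrametricDist K⸨X⸩ :=
  letI := laurentRankOne K
  Valued.instIsUltrametricDist K⸨X⸩ (WithZero (Multiplicative ℤ))

/-- The valuation of the algebraic closure of `K((t))` given by `laurentAbs`. -/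
noncomputable def laurentValuation (K : Type*) [Field K] :
    Valuation (AlgebraicClosure K⸨X⸩) ℝ≥0 :=
  letI := laurentNontriviallyNormedField K
  haveI := laurent_isUltrametricDist K
  haveI : CompleteSpace K⸨X⸩ := LaurentSeries.instLaurentSeriesComplete
  spectralValuation K⸨X⸩ (AlgebraicClosure K⸨X⸩)

theorem coe_laurentValuation {K : Type*} [Field K] (x : AlgebraicClosure K⸨X⸩) :
    (laurentValuation K x : ℝ) = laurentAbs K x := rfl

theorem laurentValuation_algEquiv {K : Type*} [Field K]
    (σ : Gal(AlgebraicClosure K⸨X⸩/K⸨X⸩)) (x : AlgebraicClosure K⸨X⸩) :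
    laurentValuation K (σ x) = laurentValuation K x := by
  let := laurentNormedField K
  exact NNReal.eq (spectralNorm_eq_of_equiv (K := K⸨X⸩) (L := AlgebraicClosure K⸨X⸩) σ x).symm

/-- The embedding of `K[[t]]` in the algebraic closure of `K((t))`. -/
noncomputable def integersToClosure (K : Type*) [Field K] :
    PowerSeries K →+* AlgebraicClosure K⸨X⸩ :=
  (algebraMap K⸨X⸩ (AlgebraicClosure K⸨X⸩)).comp (algebraMap (PowerSeries K) K⸨X⸩)

theorem integersToClosure_injective (K : Type*) [Field K] :
    Function.Injective (integersToClosure K) :=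
  (algebraMap K⸨X⸩ (AlgebraicClosure K⸨X⸩)).injective.comp
    (IsFractionRing.injective (PowerSeries K) K⸨X⸩)

/-- The two valuations are compared only at the threshold 1; the numerical value of `|t|` never
matters, only `0 < valT K < 1`. -/
theorem laurentValuation_algebraMap_le_one_iff {K : Type*} [Field K] (f : K⸨X⸩) :
    laurentValuation K (algebraMap K⸨X⸩ _ f) ≤ 1 ↔ Valued.v f ≤ 1 := by
  let := laurentRankOne K
  let := laurentNontriviallyNormedField K
  have := laurent_isUltrametricDist K
  rw [← NNReal.coe_le_coe, coe_laurentValuation, ← Valued.toNormedField.norm_le_one_iff]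
  exact iff_of_eq (congrArg (· ≤ (1 : ℝ))
    (spectralNorm_extends (K := K⸨X⸩) (L := AlgebraicClosure K⸨X⸩) f))

theorem laurentValuation_integersToClosure_le_one {K : Type*} [Field K] (f : PowerSeries K) :
    laurentValuation K (integersToClosure K f) ≤ 1 :=
  (laurentValuation_algebraMap_le_one_iff _).2
    ((LaurentSeries.val_le_one_iff_eq_coe K _).2 ⟨f, rfl⟩)

theorem laurentValuation_of_isUnit {K : Type*} [Field K] {f : PowerSeries K} (hf : IsUnit f) :
    laurentValuation K (integersToClosure K f) = 1 := by
  obtain ⟨u, rfl⟩ := hf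
  refine le_antisymm (laurentValuation_integersToClosure_le_one _) ?_
  have h : laurentValuation K (integersToClosure K u) *
      laurentValuation K (integersToClosure K (↑u⁻¹ : PowerSeries K)) = 1 := by
    rw [← map_mul, ← map_mul, Units.mul_inv, map_one, map_one]
  rw [← h]
  exact mul_le_of_le_one_right' (laurentValuation_integersToClosure_le_one _)

theorem isUnit_of_order_eq_zero {K : Type*} [Field K] {f : PowerSeries K} (hf : f.order = 0) :
    IsUnit f := by
  rw [PowerSeries.isUnit_iff_constantCoeff, isUnit_iff_ne_zero]
  intro h
  exact PowerSeries.order_ne_zero_iff_constCoeff_eq_zero.2 h hf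

theorem exists_eq_X_mul_of_order_eq_one {K : Type*} [Field K] {f : PowerSeries K}
    (hf : f.order = 1) : ∃ u, IsUnit u ∧ f = PowerSeries.X * u := by
  have h0 : PowerSeries.constantCoeff f = 0 :=
    PowerSeries.order_ne_zero_iff_constCoeff_eq_zero.1 (by simp [hf])
  obtain ⟨u, rfl⟩ := PowerSeries.X_dvd_iff.2 h0
  refine ⟨u, isUnit_of_order_eq_zero ?_, rfl⟩
  rw [PowerSeries.order_mul, PowerSeries.order_X] at hf
  cases h : u.order with
  | top => simp [h] at hf
  | coe k =>
    rw [h] at hf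
    norm_cast at hf ⊢
    omega

/-- The absolute value of the uniformizer `t`. -/
noncomputable def valT (K : Type*) [Field K] : ℝ≥0 :=
  laurentValuation K (integersToClosure K PowerSeries.X)

theorem valT_lt_one (K : Type*) [Field K] : valT K < 1 := by
  refine lt_of_le_of_ne (laurentValuation_integersToClosure_le_one _) fun h => ?_
  have h1 : laurentValuation K (integersToClosure K PowerSeries.X)⁻¹ ≤ 1 := by
    rw [map_inv₀]; exact (inv_eq_one.2 h).le
  rw [integersToClosure, RingHom.comp_apply, ← map_inv₀,
    laurentValuation_algebraMap_le_one_iff, LaurentSeries.val_le_one_iff_eq_coe] at h1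
  obtain ⟨g, hg⟩ := h1
  have hX : (PowerSeries.X * g : PowerSeries K) = 1 := by
    apply IsFractionRing.injective (PowerSeries K) K⸨X⸩
    rw [map_mul, map_one]
    rw [show algebraMap (PowerSeries K) K⸨X⸩ g = _ from hg]
    refine mul_inv_cancel₀ ?_
    rw [Ne, map_eq_zero_iff _ (IsFractionRing.injective (PowerSeries K) K⸨X⸩)]
    exact PowerSeries.X_ne_zero
  exact PowerSeries.X_prime.not_isUnit (IsUnit.of_mul_eq_one _ hX)

theorem laurentValuation_of_order_eq_one {K : Type*} [Field K] {f : PowerSeries K}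
    (hf : f.order = 1) : laurentValuation K (integersToClosure K f) = valT K := by
  obtain ⟨u, hu, rfl⟩ := exists_eq_X_mul_of_order_eq_one hf
  rw [map_mul, map_mul, laurentValuation_of_isUnit hu, mul_one, valT]

theorem valT_pos (K : Type*) [Field K] : 0 < valT K := by
  rw [valT, pos_iff_ne_zero, Ne, map_eq_zero,
    map_eq_zero_iff _ (integersToClosure_injective K)]
  exact PowerSeries.X_ne_zero

theorem laurentValuation_of_not_isUnit {K : Type*} [Field K] {f : PowerSeries K}
    (hf : ¬ IsUnit f) : laurentValuation K (integersToClosure K f) ≤ valT K := by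
  rw [PowerSeries.isUnit_iff_constantCoeff, isUnit_iff_ne_zero, not_not,
    ← PowerSeries.X_dvd_iff] at hf
  obtain ⟨u, rfl⟩ := hf
  rw [map_mul, map_mul, valT]
  exact mul_le_of_le_one_right' (laurentValuation_integersToClosure_le_one _)

/-! ### Newton polygon estimates for the roots and their differences. -/

/-- The partial sum `∑_{k < N} A_k x ^ k`. -/
def partialSum {L : Type*} [Field L] (A : ℕ → L) (x : L) (N : ℕ) : L :=
  ∑ k ∈ Finset.range N, A k * x ^ k

section Estimates

variable {L : Type*} [Field L] {v : Valuation L ℝ≥0} {A : ℕ → L}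

theorem Valuation.map_sum_Ico_le (hA : ∀ k, v (A k) ≤ 1) {x : L} (hx : v x ≤ 1) (m N : ℕ) :
    v (∑ k ∈ Finset.Ico m N, A k * x ^ k) ≤ v x ^ m := by
  refine v.map_sum_le fun k hk => ?_
  rw [map_mul, map_pow]
  exact (mul_le_of_le_one_left' (hA k)).trans
    (pow_le_pow_of_le_one zero_le hx (Finset.mem_Ico.1 hk).1)

theorem Valuation.map_pow_sub_pow_le {x y : L} {r : ℝ≥0} (hx : v x ≤ r) (hy : v y ≤ r) (k : ℕ) :
    v (y ^ (k + 1) - x ^ (k + 1)) ≤ v (y - x) * r ^ k := by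
  induction k with
  | zero => simp
  | succ k ih =>
    have h : y ^ (k + 1 + 1) - x ^ (k + 1 + 1)
        = y * (y ^ (k + 1) - x ^ (k + 1)) + (y - x) * x ^ (k + 1) := by ring
    rw [h]
    refine v.map_add_le ?_ ?_
    · rw [map_mul, pow_succ r, ← mul_assoc, mul_comm]
      exact mul_le_mul' ih hy
    · rw [map_mul, map_pow]
      exact mul_le_mul_right (pow_le_pow_left' hx _) _

/-- Each `y ^ k - x ^ k` has the factor `y - x` and a cofactor of degree `k - 1`; hence the exponent
`m` for a tail starting at `m + 1`. -/
theorem Valuation.map_sum_Ico_sub_le (hA : ∀ k, v (A k) ≤ 1) {x y : L} {r : ℝ≥0}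
    (hx : v x ≤ r) (hy : v y ≤ r) (hr : r ≤ 1) (m N : ℕ) :
    v (∑ k ∈ Finset.Ico (m + 1) N, A k * y ^ k - ∑ k ∈ Finset.Ico (m + 1) N, A k * x ^ k)
      ≤ v (y - x) * r ^ m := by
  rw [← Finset.sum_sub_distrib]
  refine v.map_sum_le fun k hk => ?_
  obtain ⟨j, rfl⟩ : ∃ j, k = j + 1 := ⟨k - 1, by have := (Finset.mem_Ico.1 hk).1; omega⟩
  rw [← mul_sub, map_mul]
  refine (mul_le_of_le_one_left' (hA _)).trans ((v.map_pow_sub_pow_le hx hy j).trans ?_)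
  have := (Finset.mem_Ico.1 hk).1
  exact mul_le_mul_right (pow_le_pow_of_le_one zero_le hr (by omega)) _

/-- The hypotheses on the coefficients `A` of the power series: relative to the absolute value
`τ` of the uniformizer, the Newton polygon has the vertices `(0, 1)` and `(q, 0)`, and the
determinant `A₁ A_q - A₀ A_{q+1}` has absolute value `τ`. -/
structure IsAffineSeries (v : Valuation L ℝ≥0) (A : ℕ → L) (q : ℕ) (τ : ℝ≥0) : Prop where
  two_le : 2 ≤ q
  pos : 0 < τ
  lt_one : τ < 1
  le_one : ∀ k, v (A k) ≤ 1
  eq_zero : ∀ k, 2 ≤ k → k < q → A k = 0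
  val_zero : v (A 0) = τ
  val_one : v (A 1) = τ
  val_q : v (A q) = 1
  val_det : v (A 1 * A q - A 0 * A (q + 1)) = τ

/-- `x` is a root of `A` in the open unit disk. -/
def IsDiskRoot (v : Valuation L ℝ≥0) (A : ℕ → L) (x : L) : Prop :=
  v x < 1 ∧ Filter.Tendsto (fun N => v (partialSum A x N)) Filter.atTop (nhds 0)

variable {q : ℕ} {τ : ℝ≥0}

theorem IsAffineSeries.partialSum_eq (h : IsAffineSeries v A q τ) (x : L) {N : ℕ}
    (hN : q + 2 ≤ N) :
    partialSum A x N = A 0 + A 1 * x + A q * x ^ q + A (q + 1) * x ^ (q + 1)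
      + ∑ k ∈ Finset.Ico (q + 2) N, A k * x ^ k := by
  have h2 := h.two_le
  rw [partialSum, ← Finset.sum_range_add_sum_Ico _ hN, Finset.sum_range_succ,
    Finset.sum_range_succ, ← Finset.sum_range_add_sum_Ico _ h2,
    Finset.sum_eq_zero (s := Finset.Ico 2 q), Finset.sum_range_succ, Finset.sum_range_one]
  · ring
  · intro k hk
    rw [Finset.mem_Ico] at hk
    rw [h.eq_zero k hk.1 hk.2, zero_mul]

theorem IsDiskRoot.eventually_lt {x : L} (hx : IsDiskRoot v A x) {ε : ℝ≥0} (hε : 0 < ε) :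
    ∀ᶠ N in Filter.atTop, v (partialSum A x N) < ε :=
  hx.2.eventually_lt_const hε

/-- `A 0` dominates the terms of degree at most 1 and `A q * x ^ q` the others; as the total is
small, these two must have equal value. -/
theorem IsAffineSeries.val_pow_root (h : IsAffineSeries v A q τ) {x : L}
    (hx : IsDiskRoot v A x) : v x ^ q = τ := by
  -- A single partial sum smaller than `τ` replaces the limit.
  obtain ⟨N, hN, hNq⟩ := ((hx.eventually_lt h.pos).and (Filter.eventually_ge_atTop (q + 2))).exists
  rw [h.partialSum_eq x hNq] at hN
  set T := ∑ k ∈ Finset.Ico (q + 2) N, A k * x ^ k with hT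
  have hTle : v T ≤ v x ^ (q + 2) := v.map_sum_Ico_le h.le_one hx.1.le _ _
  have hq : q ≠ 0 := by have := h.two_le; omega
  rcases eq_or_ne x 0 with rfl | hx0
  · have hT0 : T = 0 := by
      rw [map_zero, zero_pow (by omega)] at hTle
      exact (map_eq_zero v).1 (le_antisymm hTle zero_le)
    simp [hT0, hq, h.val_zero] at hN
  have hxpos : 0 < v x := by rwa [pos_iff_ne_zero, Ne, map_eq_zero]
  have hA1 : v (A 1 * x) < τ := by
    rw [map_mul, h.val_one]
    exact mul_lt_of_lt_one_right h.pos hx.1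
  have hlow : v (A 0 + (A 1 * x - (A 0 + A 1 * x + A q * x ^ q + A (q + 1) * x ^ (q + 1) + T)))
      = τ := by
    rw [Valuation.map_add_eq_of_lt_left, h.val_zero]
    rw [h.val_zero]
    exact v.map_sub_lt hA1 hN
  have hxq : 0 < v x ^ q := pow_pos hxpos q
  have hhigh : v (A q * x ^ q + (A (q + 1) * x ^ (q + 1) + T)) = v x ^ q := by
    have hv : v (A q * x ^ q) = v x ^ q := by rw [map_mul, map_pow, h.val_q, one_mul]
    rw [Valuation.map_add_eq_of_lt_left, hv]
    rw [hv]
    refine v.map_add_lt ?_ (hTle.trans_lt ?_)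
    · rw [map_mul, map_pow]
      refine (mul_le_of_le_one_left' (h.le_one _)).trans_lt ?_
      rw [pow_succ]
      exact mul_lt_of_lt_one_right hxq hx.1
    · rw [pow_add]
      exact mul_lt_of_lt_one_right hxq (pow_lt_one₀ zero_le hx.1 two_ne_zero)
  rw [← hhigh, ← hlow, ← Valuation.map_neg]
  congr 1
  ring

/-- This allows `A q * x ^ q` to be replaced by `-A 0`, which turns `A q * (A 1 + A (q + 1) * x ^
q)` into the determinant. -/
theorem IsAffineSeries.val_root_le (h : IsAffineSeries v A q τ) {x : L}
    (hx : IsDiskRoot v A x) : v (A q * x ^ q + A 0) ≤ τ * v x := by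
  have hxq := h.val_pow_root hx
  have hq : q ≠ 0 := by have := h.two_le; omega
  have hxpos : 0 < v x := by
    rw [pos_iff_ne_zero]
    intro h0
    rw [h0, zero_pow hq] at hxq
    exact h.pos.ne hxq
  obtain ⟨N, hN, hNq⟩ := ((hx.eventually_lt (mul_pos h.pos hxpos)).and
    (Filter.eventually_ge_atTop (q + 2))).exists
  have hTle := v.map_sum_Ico_le h.le_one hx.1.le (q + 2) N
  have hS := h.partialSum_eq x hNq
  set T := ∑ k ∈ Finset.Ico (q + 2) N, A k * x ^ k with hT
  have heq : A q * x ^ q + A 0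
      = (partialSum A x N - A 1 * x) - (A (q + 1) * x ^ (q + 1) + T) := by
    rw [hS]; ring
  rw [heq]
  refine v.map_sub_le (v.map_sub_le hN.le ?_) (v.map_add_le ?_ (hTle.trans ?_))
  · rw [map_mul, h.val_one]
  · rw [map_mul, map_pow, pow_succ, hxq]
    exact mul_le_of_le_one_left' (h.le_one _)
  · rw [pow_add, hxq, pow_two]
    exact mul_le_mul_right (mul_le_of_le_one_left' hx.1.le) _

theorem IsAffineSeries.val_sub_pow_sub_lt {p n : ℕ} [Fact p.Prime] [CharP L p]
    (h : IsAffineSeries v A q τ) (hq : q = p ^ n) {x y : L}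
    (hx : IsDiskRoot v A x) (hy : IsDiskRoot v A y) (hxy : x ≠ y) :
    v ((y - x) ^ (q - 1) + (A 1 * A q - A 0 * A (q + 1)) / A q ^ 2) < τ := by
  have h2 := h.two_le
  have hxq := h.val_pow_root hx
  have hyq := h.val_pow_root hy
  have hvy : v y = v x := (pow_left_inj₀ zero_le zero_le (by omega)).1 (hyq.trans hxq.symm)
  have hxpos : 0 < v x := by
    rw [pos_iff_ne_zero]
    intro h0
    rw [h0, zero_pow (by omega)] at hxq
    exact h.pos.ne hxq
  have hd : y - x ≠ 0 := sub_ne_zero.2 hxy.symm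
  have hdpos : 0 < v (y - x) := by rwa [pos_iff_ne_zero, Ne, map_eq_zero]
  -- Small enough that the error is still at most `τ * v x` after division by `y - x`.
  have hε : 0 < v (y - x) * (τ * v x) := mul_pos hdpos (mul_pos h.pos hxpos)
  obtain ⟨N, ⟨hNx, hNy⟩, hNq⟩ := (((hx.eventually_lt hε).and (hy.eventually_lt hε)).and
    (Filter.eventually_ge_atTop (q + 2))).exists
  have hT := v.map_sum_Ico_sub_le h.le_one le_rfl hvy.le hx.1.le (q + 1) N
  have hSx := h.partialSum_eq x hNq
  have hSy := h.partialSum_eq y hNq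
  have hroot := h.val_root_le hx
  set Tx := ∑ k ∈ Finset.Ico (q + 2) N, A k * x ^ k
  set Ty := ∑ k ∈ Finset.Ico (q + 2) N, A k * y ^ k
  set d := y - x with hddef
  set E := (Ty - Tx) - (partialSum A y N - partialSum A x N) with hE
  have hEle : v E ≤ v d * (τ * v x) := by
    refine v.map_sub_le ?_ (v.map_sub_le hNy.le hNx.le)
    rw [← hxq, ← pow_succ]
    exact hT
  -- Additivity of the `q`-power map, where `q = p ^ n` enters.
  have hdq : d ^ q = y ^ q - x ^ q := by
    rw [hddef, hq, sub_pow_char_pow]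
  have hAq : A q ≠ 0 := by
    intro h0
    have := h.val_q
    simp [h0] at this
  have hpow : d ^ q = d ^ (q - 1) * d := by rw [← pow_succ]; congr 1; omega
  have hyd : y = x + d := by rw [hddef]; ring
  have hyq' : y ^ q = x ^ q + d ^ (q - 1) * d := by rw [← hpow, hdq]; ring
  -- The difference of the two root equations divided by `d`, using `y ^ (q + 1) - x ^ (q + 1) = d ^
  -- q * y + x ^ q * d`, then multiplied by `A q`.
  have key : A q ^ 2 * (d ^ (q - 1) + (A 1 * A q - A 0 * A (q + 1)) / A q ^ 2)
      = - (A q * (A (q + 1) * (d ^ (q - 1) * y)) + A (q + 1) * (A q * x ^ q + A 0)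
        + A q * (E / d)) := by
    have hE' : E = -(A q * (d ^ (q - 1) * d) + A (q + 1) * (d ^ (q - 1) * d * y)
        + (A 1 + A (q + 1) * x ^ q) * d) := by
      rw [hE, hSx, hSy, pow_succ, pow_succ, hyq', hyd]
      ring
    rw [hE']
    field_simp
    ring
  have hle : v (d ^ (q - 1) + (A 1 * A q - A 0 * A (q + 1)) / A q ^ 2)
      ≤ max (v d ^ (q - 1)) τ * v x := by
    have hv := congrArg v key
    rw [map_mul, map_pow, h.val_q, one_pow, one_mul, Valuation.map_neg] at hv
    rw [hv]
    refine v.map_add_le (v.map_add_le ?_ ?_) ?_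
    · rw [map_mul, h.val_q, one_mul, map_mul, map_mul, map_pow, hvy]
      exact (mul_le_of_le_one_left' (h.le_one _)).trans (mul_le_mul_left (le_max_left _ _) _)
    · rw [map_mul]
      exact (mul_le_of_le_one_left' (h.le_one _)).trans
        (hroot.trans (mul_le_mul_left (le_max_right _ _) _))
    · rw [map_mul, h.val_q, one_mul, map_div₀, div_le_iff₀ hdpos, mul_comm _ (v d)]
      exact hEle.trans (mul_le_mul_right (mul_le_mul_left (le_max_right _ _) _) _)
  have hc : v ((A 1 * A q - A 0 * A (q + 1)) / A q ^ 2) = τ := by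
    rw [map_div₀, map_pow, h.val_q, one_pow, div_one, h.val_det]
  -- Otherwise the left side of `hle` has value `v d ^ (q - 1)`, while `hle` bounds it by that value
  -- times `v x < 1`.
  have hwle : v d ^ (q - 1) ≤ τ := by
    by_contra! hlt
    rw [Valuation.map_add_eq_of_lt_left _ (by rwa [hc, map_pow]), map_pow,
      max_eq_left hlt.le] at hle
    exact absurd hle (mul_lt_of_lt_one_right (h.pos.trans hlt) hx.1).not_ge
  rw [max_eq_right hwle] at hle
  exact hle.trans_lt (mul_lt_of_lt_one_right h.pos hx.1)

end Estimates

/-! ### Counting conjugates. -/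

theorem index_stabilizer_eq_natDegree_minpoly {F L : Type*} [Field F] [Field L] [Algebra F L]
    [Normal F L] {x : L} (hx : IsSeparable F x) :
    (MulAction.stabilizer Gal(L/F) x).index = (minpoly F x).natDegree := by
  have horb : MulAction.orbit Gal(L/F) x = (minpoly F x).rootSet L := by
    ext y
    rw [← isConjRoot_iff_mem_minpoly_rootSet hx.isIntegral, IsConjRoot.comm,
      isConjRoot_iff_orbitRel, MulAction.orbitRel_apply]
  rw [MulAction.index_stabilizer, horb, ← Nat.card_coe_set_eq, Nat.card_eq_fintype_card]
  exact Polynomial.card_rootSet_eq_natDegree hx (Normal.splits inferInstance x)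

/-! ### The copy of a finite field as representatives of residues. -/

section Teichmuller

variable {k L : Type*} [Field k] [Field L] (φ : k →+* L) {v : Valuation L ℝ≥0}

theorem prod_sub_map_eq [Fintype k] (y : L) :
    ∏ a : k, (y - φ a) = y ^ Nat.card k - y := by
  have h : (Polynomial.X ^ Fintype.card k - Polynomial.X : Polynomial k)
      = ∏ a : k, (Polynomial.X - Polynomial.C a) := by
    have h1 : (Polynomial.X ^ Fintype.card k - Polynomial.X : Polynomial k).Monic :=
      Polynomial.monic_X_pow_sub (by
        rw [Polynomial.degree_X]; exact_mod_cast Fintype.one_lt_card)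
    have h2 := FiniteField.roots_X_pow_card_sub_X k
    have h3 := Polynomial.prod_multiset_X_sub_C_of_monic_of_roots_card_eq h1 (by
      rw [h2, FiniteField.X_pow_card_sub_X_natDegree_eq k Fintype.one_lt_card]; rfl)
    rw [← h3, h2]
    rfl
  have h' := congrArg (Polynomial.eval₂ φ y) h
  rw [Polynomial.eval₂_finsetProd] at h'
  simpa [Nat.card_eq_fintype_card] using h'.symm

theorem exists_eq_map_of_pow_eq_self [Finite k] {y : L} (hy : y ^ Nat.card k = y) : ∃ a, y = φ a := by
  have := Fintype.ofFinite k
  have h := prod_sub_map_eq φ y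
  rw [hy, sub_self, Finset.prod_eq_zero_iff] at h
  obtain ⟨a, -, ha⟩ := h
  exact ⟨a, sub_eq_zero.1 ha⟩

/-- `y ^ q - y` is the product of the `y - φ a`, so the factors cannot all have value at least 1. -/
theorem exists_val_sub_map_lt_one [Finite k] {y : L} (hy : v (y ^ Nat.card k - y) < 1) :
    ∃ a, v (y - φ a) < 1 := by
  have := Fintype.ofFinite k
  by_contra! h
  refine hy.not_ge ?_
  rw [← prod_sub_map_eq φ y, map_prod]
  exact Finset.prod_induction _ (1 ≤ ·) (fun _ _ => one_le_mul) le_rfl fun a _ => h a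

theorem Valuation.map_eq_one_of_finite [Finite k] {a : k} (ha : a ≠ 0) : v (φ a) = 1 := by
  have := Fintype.ofFinite k
  have h : v (φ a) ^ (Fintype.card k - 1) = 1 := by
    rw [← map_pow, ← map_pow, FiniteField.pow_card_sub_one_eq_one a ha, map_one, map_one]
  exact (pow_eq_one_iff_of_nonneg zero_le (by have := Fintype.one_lt_card (α := k); omega)).1 h

theorem eq_of_val_sub_map_lt_one [Finite k] {y : L} {a b : k} (ha : v (y - φ a) < 1)
    (hb : v (y - φ b) < 1) : a = b := by
  by_contra hab
  have h := v.map_sub_lt ha hb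
  rw [show y - φ a - (y - φ b) = φ (b - a) by rw [map_sub]; ring,
    Valuation.map_eq_one_of_finite φ (sub_ne_zero.2 (Ne.symm hab))] at h
  exact h.false

end Teichmuller

/-! ### Recognizing the affine group. -/

theorem card_AGLOne_le (k : Type*) [Field k] [Finite k] :
    Nat.card (AGLOne k) ≤ Nat.card k * (Nat.card k - 1) := by
  have hne (σ : AGLOne k) : σ.1 1 - σ.1 0 ≠ 0 :=
    sub_ne_zero.2 fun h => one_ne_zero (σ.1.injective h)
  have hinj : Function.Injective
      fun σ : AGLOne k => (σ.1 0, Units.mk0 (σ.1 1 - σ.1 0) (hne σ)) := by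
    rintro ⟨σ, a, b, ha, hσ⟩ ⟨τ, c, d, hc, hτ⟩ h
    simp only [Prod.mk.injEq, Units.mk0_inj, hσ, hτ] at h
    have hbd : b = d := by simpa using h.1
    have hac : a = c := by simpa using h.2
    refine Subtype.ext (Equiv.ext fun x => ?_)
    change σ x = τ x
    rw [hσ, hτ, hbd, hac]
  calc Nat.card (AGLOne k) ≤ Nat.card (k × kˣ) := Nat.card_le_card_of_injective _ hinj
    _ = Nat.card k * (Nat.card k - 1) := by rw [Nat.card_prod, Nat.card_units]

/-- A finite Galois-stable set of `q` elements whose differences, divided by an element `δ` with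
`δ ^ (q - 1)` in the base field, are close to `(q - 1)`-st roots of unity, is permuted by the
Galois group like an affine line, provided that one of its elements and `δ` have as many
conjugates as possible. -/
theorem exists_equiv_map_range_eq_AGLOne {F L k : Type*} [Field F] [Field L] [Algebra F L]
    [Field k] [Finite k] (ψ : k →+* F) {v : Valuation L ℝ≥0}
    (hv : ∀ (σ : Gal(L/F)) (x : L), v (σ x) = v x) (R : SubMulAction Gal(L/F) L)
    (hcard : Nat.card R = Nat.card k) (α : R) {δ : L} (hδ : δ ≠ 0)
    (hδpow : ∃ c : F, δ ^ (Nat.card k - 1) = algebraMap F L c)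
    (hdiff : ∀ x ∈ R, ∀ y ∈ R, x ≠ y → v (((y - x) / δ) ^ (Nat.card k - 1) - 1) < 1)
    (hα : (MulAction.stabilizer Gal(L/F) (α : L)).index = Nat.card k)
    (hδi : (MulAction.stabilizer Gal(L/F) δ).index = Nat.card k - 1) :
    ∃ e : R ≃ k, ((MulAction.toPermHom Gal(L/F) R).range).map e.permCongrHom.toMonoidHom
      = AGLOne k := by
  set φ : k →+* L := (algebraMap F L).comp ψ with hφ
  have hσφ (σ : Gal(L/F)) (a : k) : σ (φ a) = φ a := σ.commutes _
  set q := Nat.card k with hq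
  have hq1 : 1 < q := Finite.one_lt_card
  have hqs : q - 1 + 1 = q := by omega
  have hunit : ∀ x ∈ R, ∀ y ∈ R, x ≠ y → v ((y - x) / δ) = 1 := by
    intro x hx y hy hxy
    have h := hdiff x hx y hy hxy
    have h1 : v (((y - x) / δ) ^ (q - 1)) = 1 := by
      rw [← Valuation.map_one v] at h
      have := Valuation.map_add_eq_of_lt_left v h
      rwa [add_sub_cancel, map_one] at this
    rw [map_pow] at h1
    exact (pow_eq_one_iff_of_nonneg zero_le (by omega)).1 h1
  -- The coordinate of `x` is the residue of `(x - α) / δ`.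
  have hex (x : R) : ∃ a : k, v (((x : L) - α) / δ - φ a) < 1 := by
    refine exists_val_sub_map_lt_one φ ?_
    rw [← hq]
    rcases eq_or_ne (α : L) x with h | h
    · rw [h, sub_self, zero_div, zero_pow (by omega), sub_zero, map_zero]
      exact zero_lt_one
    · have h1 := hdiff α α.2 x x.2 h
      rw [← hqs, pow_succ, ← sub_one_mul, map_mul, hunit α α.2 x x.2 h, mul_one]
      exact h1
  choose e he using hex
  have heq {x : R} {a : k} (h : v (((x : L) - α) / δ - φ a) < 1) : e x = a :=
    eq_of_val_sub_map_lt_one φ (he x) h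
  have hinj : Function.Injective e := by
    intro x y hxy
    by_contra hne
    have hlt := v.map_sub_lt (he y) (hxy ▸ he x)
    rw [sub_sub_sub_cancel_right, ← sub_div, sub_sub_sub_cancel_right,
      hunit x x.2 y y.2 (fun h => hne (Subtype.ext h))] at hlt
    exact hlt.false
  have hbij : Function.Bijective e :=
    hinj.bijective_of_nat_card_le hcard.ge
  have hu (σ : Gal(L/F)) : ∃ u : k, σ δ = φ u * δ := by
    obtain ⟨c, hc⟩ := hδpow
    obtain ⟨u, hu⟩ := exists_eq_map_of_pow_eq_self φ (y := σ δ / δ) (by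
      have h1 : (σ δ / δ) ^ (q - 1) = 1 := by
        rw [div_pow, ← map_pow, hc, σ.commutes, div_self]
        rw [← hc]
        exact pow_ne_zero _ hδ
      rw [← hq, ← hqs, pow_succ, h1, one_mul])
    exact ⟨u, by rw [← hu, div_mul_cancel₀ _ hδ]⟩
  have haff (σ : Gal(L/F)) {u : k} (hu : σ δ = φ u * δ) (x : R) :
      e (σ • x) = u * e x + e (σ • α) := by
    have hu0 : φ u ≠ 0 := by
      intro h
      rw [h, zero_mul] at hu
      exact hδ ((map_eq_zero σ).1 hu)
    have hu1 : v (φ u) = 1 :=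
      Valuation.map_eq_one_of_finite φ fun h => hu0 (by rw [h, map_zero])
    -- `(σ x - α) / δ = (σ α - α) / δ + u * σ ((x - α) / δ)`, and `σ` preserves `v` and fixes the
    -- residue representatives.
    refine heq ?_
    have h1 := he (σ • α)
    have h2 : v (φ u * σ (((x : L) - α) / δ - φ (e x))) < 1 := by
      rw [map_mul, hu1, one_mul, hv]
      exact he x
    have h3 := v.map_add_lt h1 h2
    convert h3 using 2
    simp only [SubMulAction.val_smul, AlgEquiv.smul_def, map_sub, map_div₀, hσφ, hu, map_add,
      map_mul]
    field_simp
    ring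
  set E : R ≃ k := Equiv.ofBijective e hbij with hE
  refine ⟨E, ?_⟩
  set T := MulAction.toPermHom Gal(L/F) R with hT
  have hle : T.range.map E.permCongrHom.toMonoidHom ≤ AGLOne k := by
    rintro _ ⟨_, ⟨σ, rfl⟩, rfl⟩
    obtain ⟨u, huσ⟩ := hu σ
    refine ⟨u, e (σ • α), ?_, fun x => ?_⟩
    · rintro rfl
      rw [map_zero, zero_mul] at huσ
      exact hδ ((map_eq_zero σ).1 huσ)
    · obtain ⟨y, rfl⟩ := E.surjective x
      have : E.permCongrHom.toMonoidHom (T σ) (E y) = E (σ • y) := by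
        simp [Equiv.permCongrHom, hT]
      rw [this]
      exact haff σ huσ y
  have hfinR : Finite R := Finite.of_equiv k E.symm
  have hkerα : T.ker ≤ MulAction.stabilizer Gal(L/F) (α : L) := by
    intro σ hσ
    have h : σ • α = α := congrArg (fun τ : Equiv.Perm R => τ α) hσ
    exact congrArg Subtype.val h
  have hkerδ : T.ker ≤ MulAction.stabilizer Gal(L/F) δ := by
    intro σ hσ
    obtain ⟨u, huσ⟩ := hu σ
    have h (x : R) : σ • x = x := congrArg (fun τ : Equiv.Perm R => τ x) hσ
    -- An element fixing the points with coordinates 0 and 1 has multiplier `u = 1`, so it fixes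
    -- `δ`.
    obtain ⟨x, hx⟩ := hbij.2 1
    have h0 := haff σ huσ α
    have h1 := haff σ huσ x
    have hα0 : e α = 0 := heq (by simp)
    rw [h, h, hx, hα0, mul_one, add_zero] at h1
    rw [MulAction.mem_stabilizer_iff, AlgEquiv.smul_def, huσ, ← h1, map_one, one_mul]
  have hdvd : q * (q - 1) ∣ Nat.card T.range := by
    rw [← Subgroup.index_ker]
    refine Nat.Coprime.mul_dvd_of_dvd_of_dvd ?_ ?_ ?_
    · rw [← hqs, Nat.add_sub_cancel]
      simp
    · exact hα ▸ Subgroup.index_dvd_of_le hkerα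
    · exact hδi ▸ Subgroup.index_dvd_of_le hkerδ
  refine Subgroup.eq_of_le_of_card_ge hle ((card_AGLOne_le k).trans ?_)
  rw [Subgroup.card_map_of_injective E.permCongrHom.injective]
  exact Nat.le_of_dvd Nat.card_pos hdvd

/-! ### Weierstrass factorization and Eisenstein polynomials over `K[[t]]`. -/

instance PowerSeries.isAdicComplete_maximalIdeal (K : Type*) [Field K] :
    IsAdicComplete (IsLocalRing.maximalIdeal (PowerSeries K)) (PowerSeries K) := by
  rw [PowerSeries.maximalIdeal_eq_span_X]
  infer_instance

/-- The values under `integersToClosure` of the coefficients of `Q`. -/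
noncomputable def closureCoeff {K : Type*} [Field K] (Q : PowerSeries (PowerSeries K)) (k : ℕ) :
    AlgebraicClosure K⸨X⸩ :=
  integersToClosure K (PowerSeries.coeff k Q)

theorem mem_diskRoots_iff {K : Type*} [Field K] {Q : PowerSeries (PowerSeries K)}
    {x : AlgebraicClosure K⸨X⸩} :
    x ∈ diskRoots Q ↔ IsDiskRoot (laurentValuation K) (closureCoeff Q) x := by
  refine and_congr (NNReal.coe_lt_coe (r₁ := laurentValuation K x) (r₂ := 1)) ?_
  exact NNReal.tendsto_coe (x := 0)
    (m := fun N => laurentValuation K (partialSum (closureCoeff Q) x N))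

theorem partialSum_closureCoeff {K : Type*} [Field K] (Q : PowerSeries (PowerSeries K))
    (x : AlgebraicClosure K⸨X⸩) (N : ℕ) :
    partialSum (closureCoeff Q) x N
      = (PowerSeries.trunc N Q).eval₂ (integersToClosure K) x := by
  rw [PowerSeries.eval₂_trunc_eq_sum_range]
  rfl

theorem laurentValuation_eval₂_le {K : Type*} [Field K] {D : Polynomial (PowerSeries K)} {N : ℕ}
    (hD : Polynomial.X ^ N ∣ D) {x : AlgebraicClosure K⸨X⸩} (hx : laurentValuation K x ≤ 1) :
    laurentValuation K (D.eval₂ (integersToClosure K) x) ≤ laurentValuation K x ^ N := by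
  obtain ⟨G, rfl⟩ := hD
  rw [Polynomial.eval₂_mul, Polynomial.eval₂_X_pow, map_mul, map_pow]
  refine mul_le_of_le_one_right' ?_
  rw [Polynomial.eval₂_eq_sum_range]
  refine Valuation.map_sum_le _ fun i _ => ?_
  rw [map_mul, map_pow]
  exact mul_le_one' (laurentValuation_integersToClosure_le_one _) (pow_le_one' hx _)

/-- Bounds by `|x| ^ N` the error in replacing a partial sum of `f * U` by `f(x)` times that of `U`.
-/
theorem X_pow_dvd_trunc_mul_sub {R : Type*} [CommRing R] (f : Polynomial R) (U : PowerSeries R)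
    (N : ℕ) : Polynomial.X ^ N ∣ f * PowerSeries.trunc N U - PowerSeries.trunc N ((f : PowerSeries R) * U) := by
  rw [Polynomial.X_pow_dvd_iff]
  intro d hd
  rw [Polynomial.coeff_sub, PowerSeries.coeff_trunc, if_pos hd, sub_eq_zero,
    ← Polynomial.coeff_coe, Polynomial.coe_mul, PowerSeries.coeff_mul, PowerSeries.coeff_mul]
  refine Finset.sum_congr rfl fun i hi => ?_
  have := Finset.HasAntidiagonal.mem_antidiagonal.1 hi
  rw [Polynomial.coeff_coe (PowerSeries.trunc N U), PowerSeries.coeff_trunc, if_pos (by omega)]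

/-- For `|x| ≥ 1` the leading term would strictly dominate, the other coefficients being divisible
by `t`. -/
theorem laurentValuation_lt_one_of_isDistinguishedAt {K : Type*} [Field K]
    {f : Polynomial (PowerSeries K)}
    (hf : f.IsDistinguishedAt (IsLocalRing.maximalIdeal (PowerSeries K)))
    {x : AlgebraicClosure K⸨X⸩} (hx : f.eval₂ (integersToClosure K) x = 0) :
    laurentValuation K x < 1 := by
  by_contra! h
  rw [Polynomial.eval₂_eq_sum_range, Finset.sum_range_succ, hf.monic.coeff_natDegree, map_one,
    one_mul, add_comm, add_eq_zero_iff_eq_neg] at hx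
  have h1 := congrArg (laurentValuation K) hx
  rw [Valuation.map_neg, map_pow] at h1
  have hpos : 0 < laurentValuation K x ^ f.natDegree := pow_pos (zero_lt_one.trans_le h) _
  have h2 : laurentValuation K (∑ i ∈ Finset.range f.natDegree,
      integersToClosure K (f.coeff i) * x ^ i) ≤ valT K * laurentValuation K x ^ f.natDegree := by
    refine Valuation.map_sum_le _ fun i hi => ?_
    have hi' := Finset.mem_range.1 hi
    rw [map_mul, map_pow]
    exact mul_le_mul' (laurentValuation_of_not_isUnit
      ((IsLocalRing.mem_maximalIdeal _).1 (hf.mem hi'))) (pow_le_pow_right₀ h hi'.le)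
  rw [← h1] at h2
  exact h2.not_gt (mul_lt_of_lt_one_left hpos (valT_lt_one K))

/-- The roots in the open unit disk of the product of a distinguished polynomial with a unit are
the roots of the polynomial. -/
theorem mem_diskRoots_iff_eval₂_eq_zero {K : Type*} [Field K] {f : Polynomial (PowerSeries K)}
    (hf : f.IsDistinguishedAt (IsLocalRing.maximalIdeal (PowerSeries K)))
    {U : PowerSeries (PowerSeries K)} (hU : IsUnit U) {x : AlgebraicClosure K⸨X⸩} :
    x ∈ diskRoots ((f : PowerSeries (PowerSeries K)) * U)
      ↔ f.eval₂ (integersToClosure K) x = 0 := by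
  set v := laurentValuation K
  set y := f.eval₂ (integersToClosure K) x with hy
  have happrox (hx : v x < 1) (N : ℕ) :
      v (y * partialSum (closureCoeff U) x N - partialSum (closureCoeff ((f : PowerSeries (PowerSeries K)) * U)) x N)
        ≤ v x ^ N := by
    rw [partialSum_closureCoeff, partialSum_closureCoeff, hy, ← Polynomial.eval₂_mul,
      ← Polynomial.eval₂_sub]
    exact laurentValuation_eval₂_le (X_pow_dvd_trunc_mul_sub f U N) hx.le
  have hlim (hx : v x < 1) : Filter.Tendsto (fun N => v x ^ N) Filter.atTop (nhds 0) :=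
    tendsto_pow_atTop_nhds_zero_of_lt_one zero_le hx
  rw [mem_diskRoots_iff]
  constructor
  · rintro ⟨hx, ht⟩
    -- The unit constant term of `U` dominates, so `|f(x)|` is at most the larger of `|x| ^ N` and
    -- the `N`-th partial sum of `f * U`.
    have hunit {N : ℕ} (hN : 1 ≤ N) : v (partialSum (closureCoeff U) x N) = 1 := by
      have h0 : v (closureCoeff U 0) = 1 := by
        refine laurentValuation_of_isUnit ?_
        rw [PowerSeries.coeff_zero_eq_constantCoeff]
        exact hU.map _
      rw [partialSum, ← Finset.sum_range_add_sum_Ico _ hN, Finset.sum_range_one, pow_zero,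
        mul_one, Valuation.map_add_eq_of_lt_left, h0]
      rw [h0]
      refine (Valuation.map_sum_Ico_le (fun k => laurentValuation_integersToClosure_le_one _)
        hx.le 1 N).trans_lt ?_
      rwa [pow_one]
    rw [← map_eq_zero v]
    have hmax := (hlim hx).max ht
    rw [max_self] at hmax
    refine le_antisymm (ge_of_tendsto hmax ?_) zero_le
    filter_upwards [Filter.eventually_ge_atTop 1] with N hN
    have h1 := v.map_add (y * partialSum (closureCoeff U) x N
      - partialSum (closureCoeff ((f : PowerSeries (PowerSeries K)) * U)) x N) (partialSum (closureCoeff ((f : PowerSeries (PowerSeries K)) * U)) x N)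
    rw [sub_add_cancel, map_mul, hunit hN, mul_one] at h1
    exact h1.trans (max_le_max_right _ (happrox hx N))
  · intro h
    have hx := laurentValuation_lt_one_of_isDistinguishedAt hf h
    refine ⟨hx, tendsto_of_tendsto_of_tendsto_of_le_of_le tendsto_const_nhds (hlim hx)
      (fun _ => zero_le) fun N => ?_⟩
    have := happrox hx N
    rwa [h, zero_mul, zero_sub, Valuation.map_neg] at this

/-- An Eisenstein polynomial over `K[[t]]` is irreducible over `K((t))`. -/
theorem irreducible_map_of_isDistinguishedAt {K : Type*} [Field K]
    {f : Polynomial (PowerSeries K)}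
    (hf : f.IsDistinguishedAt (IsLocalRing.maximalIdeal (PowerSeries K)))
    (hdeg : 0 < f.natDegree) (h0 : (f.coeff 0).order = 1) :
    Irreducible (f.map (algebraMap (PowerSeries K) K⸨X⸩)) := by
  rw [← hf.monic.irreducible_iff_irreducible_map_fraction_map]
  refine Polynomial.IsEisensteinAt.irreducible (𝓟 := IsLocalRing.maximalIdeal (PowerSeries K))
    ⟨?_, fun h => hf.mem h, ?_⟩ inferInstance hf.monic.isPrimitive hdeg
  · rw [hf.monic.leadingCoeff]
    exact (Ideal.ne_top_iff_one _).1 Ideal.IsPrime.ne_top'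
  · rw [PowerSeries.maximalIdeal_eq_span_X, Ideal.span_singleton_pow,
      Ideal.mem_span_singleton]
    intro h
    have h2 := PowerSeries.nat_le_order _ 2 (PowerSeries.X_pow_dvd_iff.1 h)
    rw [h0] at h2
    norm_cast at h2

/-- The degree of `f` is the order of `Q` modulo `t`; the constant terms of `f` and `Q` differ by
the unit `U(0)`. -/
theorem exists_isDistinguishedAt_mul {K : Type*} [Field K] {Q : PowerSeries (PowerSeries K)}
    {q : ℕ} (hlow : ∀ k < q, ¬ IsUnit (PowerSeries.coeff k Q))
    (hunit : IsUnit (PowerSeries.coeff q Q)) :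
    ∃ (f : Polynomial (PowerSeries K)) (U : PowerSeries (PowerSeries K)),
      f.IsDistinguishedAt (IsLocalRing.maximalIdeal (PowerSeries K)) ∧ IsUnit U ∧
      Q = f * U ∧ f.natDegree = q ∧ (f.coeff 0).order = (PowerSeries.coeff 0 Q).order := by
  have hcoeff (k : ℕ) : PowerSeries.coeff k (Q.map (IsLocalRing.residue (PowerSeries K))) = 0
      ↔ ¬ IsUnit (PowerSeries.coeff k Q) := by
    rw [PowerSeries.coeff_map, IsLocalRing.residue_eq_zero_iff, IsLocalRing.mem_maximalIdeal,
      mem_nonunits_iff]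
  have hne : Q.map (IsLocalRing.residue (PowerSeries K)) ≠ 0 := by
    intro h
    exact (hcoeff q).1 (by rw [h, map_zero]) hunit
  obtain ⟨f, U, H⟩ := PowerSeries.exists_isWeierstrassFactorization hne
  refine ⟨f, U, H.isDistinguishedAt, H.isUnit, H.eq_mul, ?_, ?_⟩
  · rw [H.natDegree_eq_toNat_order_map, (PowerSeries.order_eq_nat (n := q)).2, ENat.toNat_natCast]
    exact ⟨fun h => (hcoeff q).1 h hunit, fun k hk => (hcoeff k).2 (hlow k hk)⟩
  · have hU : (PowerSeries.constantCoeff U).order = 0 :=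
      PowerSeries.order_zero_of_unit (H.isUnit.map PowerSeries.constantCoeff)
    rw [H.eq_mul, PowerSeries.coeff_zero_eq_constantCoeff, map_mul, PowerSeries.order_mul, hU,
      add_zero]
    simp

/-- An Eisenstein polynomial over `K[[t]]` is the minimal polynomial of its roots. -/
theorem minpoly_eq_map_of_isDistinguishedAt {K : Type*} [Field K]
    {f : Polynomial (PowerSeries K)}
    (hf : f.IsDistinguishedAt (IsLocalRing.maximalIdeal (PowerSeries K)))
    (hdeg : 0 < f.natDegree) (h0 : (f.coeff 0).order = 1) {x : AlgebraicClosure K⸨X⸩}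
    (hx : f.eval₂ (integersToClosure K) x = 0) :
    minpoly K⸨X⸩ x = f.map (algebraMap (PowerSeries K) K⸨X⸩) := by
  refine (minpoly.eq_of_irreducible_of_monic
    (irreducible_map_of_isDistinguishedAt hf hdeg h0) ?_ (hf.monic.map _)).symm
  rw [Polynomial.aeval_def, Polynomial.eval₂_map]
  exact hx

theorem irreducible_X_pow_sub_C_of_order_eq_one {K : Type*} [Field K] {m : ℕ} (hm : 0 < m)
    {c : PowerSeries K} (hc : c.order = 1) :
    Irreducible (Polynomial.X ^ m - Polynomial.C (algebraMap (PowerSeries K) K⸨X⸩ c)) := by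
  have hc0 : ¬ IsUnit c := fun h => by
    have := PowerSeries.order_zero_of_unit h
    simp [hc] at this
  have h := irreducible_map_of_isDistinguishedAt
    (f := (Polynomial.X ^ m - Polynomial.C c : Polynomial (PowerSeries K)))
    ⟨⟨fun {i} hi => ?_⟩, Polynomial.monic_X_pow_sub_C c hm.ne'⟩
    (by rwa [Polynomial.natDegree_X_pow_sub_C]) (by simp [hm.ne, hc])
  · simpa using h
  · rw [Polynomial.natDegree_X_pow_sub_C] at hi
    rw [Polynomial.coeff_sub, Polynomial.coeff_X_pow, if_neg hi.ne, zero_sub, neg_mem_iff,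
      Polynomial.coeff_C]
    split_ifs
    · exact (IsLocalRing.mem_maximalIdeal _).2 hc0
    · exact zero_mem _

/-- `X ^ m - c` is Eisenstein, and separable because `m` is invertible. -/
theorem index_stabilizer_of_pow_eq {K : Type*} [Field K] {m : ℕ} (hm : 0 < m) (hmK : (m : K) ≠ 0)
    {c : PowerSeries K} (hc : c.order = 1) {δ : AlgebraicClosure K⸨X⸩}
    (hδ : δ ^ m = integersToClosure K c) :
    (MulAction.stabilizer Gal(AlgebraicClosure K⸨X⸩/K⸨X⸩) δ).index = m := by
  have hirr := irreducible_X_pow_sub_C_of_order_eq_one hm hc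
  have hmin : minpoly K⸨X⸩ δ
      = Polynomial.X ^ m - Polynomial.C (algebraMap (PowerSeries K) K⸨X⸩ c) := by
    refine (minpoly.eq_of_irreducible_of_monic hirr ?_
      (Polynomial.monic_X_pow_sub_C _ hm.ne')).symm
    simp [hδ, integersToClosure]
  have hmF : (m : K⸨X⸩) ≠ 0 := by
    rw [← map_natCast (algebraMap K K⸨X⸩)]
    exact (map_ne_zero _).2 hmK
  have hc0 : algebraMap (PowerSeries K) K⸨X⸩ c ≠ 0 := by
    rw [Ne, map_eq_zero_iff _ (IsFractionRing.injective (PowerSeries K) K⸨X⸩)]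
    rintro rfl
    simp at hc
  rw [index_stabilizer_eq_natDegree_minpoly, hmin, Polynomial.natDegree_X_pow_sub_C]
  rw [IsSeparable, hmin]
  exact Polynomial.separable_X_pow_sub_C _ hmF hc0

/-! ### Coefficients of `Q` and the final assembly. -/

section Coefficients

variable {R : Type*} [CommRing R] {q : ℕ} {P Q : PowerSeries R} {a₀ a₁ aq aq1 : R}

theorem coeff_of_eq_affine
    (hQ : Q = PowerSeries.X ^ (q + 2) * P + PowerSeries.C aq1 * PowerSeries.X ^ (q + 1)
      + PowerSeries.C aq * PowerSeries.X ^ q + PowerSeries.C a₁ * PowerSeries.X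
      + PowerSeries.C a₀) {k : ℕ} (hk : k < q + 2) :
    PowerSeries.coeff k Q = (if k = q + 1 then aq1 else 0) + (if k = q then aq else 0)
      + (if k = 1 then a₁ else 0) + (if k = 0 then a₀ else 0) := by
  rw [hQ]
  simp only [map_add, PowerSeries.coeff_C_mul, PowerSeries.coeff_X_pow, PowerSeries.coeff_X,
    PowerSeries.coeff_C, PowerSeries.coeff_X_pow_mul', if_neg hk.not_ge, mul_ite, mul_one,
    mul_zero, zero_add]

end Coefficients

theorem lemma3p2 {K : Type*} [Field K] [IsAlgClosed K] (p : ℕ) [Fact p.Prime] [CharP K p]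
    (n : ℕ) (hn : 1 ≤ n) (q : ℕ) (hq : q = p ^ n)
    (P Q : PowerSeries (PowerSeries K)) (a₀ a₁ aq aq1 : PowerSeries K)
    (hQ : Q = PowerSeries.X ^ (q + 2) * P + PowerSeries.C aq1 * PowerSeries.X ^ (q + 1)
      + PowerSeries.C aq * PowerSeries.X ^ q + PowerSeries.C a₁ * PowerSeries.X
      + PowerSeries.C a₀)
    (ha₀ : a₀.order = 1) (ha₁ : a₁.order = 1) (haq : aq.order = 0)
    (hdet : (a₁ * aq - a₀ * aq1).order = 1)
    (hsep : ∀ x ∈ diskRoots Q, IsSeparable K⸨X⸩ x) :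
    Nat.card (diskRoots Q) = q ∧
      ∃ e : diskRoots Q ≃ GaloisField p n,
        (galPermDiskRoots Q).range.map e.permCongrHom.toMonoidHom
          = AGLOne (GaloisField p n) := by
  have hp : 2 ≤ p := (Fact.out : p.Prime).two_le
  -- This keeps the exponents `0, 1, q, q + 1` distinct.
  have hq2 : 2 ≤ q := hp.trans (hq ▸ Nat.le_self_pow (by omega) p)
  have hcoeff {k : ℕ} (hk : k < q + 2) := coeff_of_eq_affine hQ hk
  have hc0 : PowerSeries.coeff 0 Q = a₀ := by
    rw [hcoeff (by omega), if_neg (by omega), if_neg (by omega), if_neg (by omega), if_pos rfl]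
    simp
  have hc1 : PowerSeries.coeff 1 Q = a₁ := by
    rw [hcoeff (by omega), if_neg (by omega), if_neg (by omega), if_pos rfl, if_neg (by omega)]
    simp
  have hcq : PowerSeries.coeff q Q = aq := by
    rw [hcoeff (by omega), if_neg (by omega), if_pos rfl, if_neg (by omega), if_neg (by omega)]
    simp
  have hcq1 : PowerSeries.coeff (q + 1) Q = aq1 := by
    rw [hcoeff (by omega), if_pos rfl, if_neg (by omega), if_neg (by omega), if_neg (by omega)]
    simp
  have hcmid {k : ℕ} (h2 : 2 ≤ k) (hk : k < q) : PowerSeries.coeff k Q = 0 := by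
    rw [hcoeff (by omega), if_neg (by omega), if_neg (by omega), if_neg (by omega),
      if_neg (by omega)]
    simp
  have hnonunit {a : PowerSeries K} (ha : a.order = 1) : ¬ IsUnit a := fun h => by
    have := PowerSeries.order_zero_of_unit h
    simp [ha] at this
  have haqu : IsUnit aq := isUnit_of_order_eq_zero haq
  obtain ⟨f, U, hf, hU, hfU, hfdeg, hf0⟩ := exists_isDistinguishedAt_mul (Q := Q) (q := q)
    (fun k hk => by
      rcases (by omega : k = 0 ∨ k = 1 ∨ 2 ≤ k) with rfl | rfl | h
      · rw [hc0]; exact hnonunit ha₀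
      · rw [hc1]; exact hnonunit ha₁
      · rw [hcmid h hk]; exact not_isUnit_zero) (hcq ▸ haqu)
  rw [hc0, ha₀] at hf0
  have hdeg : 0 < f.natDegree := by omega
  have hmem (x : AlgebraicClosure K⸨X⸩) :
      x ∈ diskRoots Q ↔ f.eval₂ (integersToClosure K) x = 0 := by
    rw [hfU]; exact mem_diskRoots_iff_eval₂_eq_zero hf hU
  have hmin {x : AlgebraicClosure K⸨X⸩} (hx : x ∈ diskRoots Q) :=
    minpoly_eq_map_of_isDistinguishedAt hf hdeg hf0 ((hmem x).1 hx)
  have hmindeg {x : AlgebraicClosure K⸨X⸩} (hx : x ∈ diskRoots Q) :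
      (minpoly K⸨X⸩ x).natDegree = q := by
    rw [hmin hx, hf.monic.natDegree_map, hfdeg]
  obtain ⟨α, hα⟩ : ∃ α, α ∈ diskRoots Q := by
    obtain ⟨α, hα⟩ := IsAlgClosed.exists_eval₂_eq_zero_of_injective (integersToClosure K)
      (integersToClosure_injective K) f
      (fun h => by rw [Polynomial.degree_eq_natDegree hf.monic.ne_zero] at h; norm_cast at h; omega)
    exact ⟨α, (hmem α).2 hα⟩
  have hcard : Nat.card (diskRoots Q) = q := by
    -- The roots are exactly the conjugates of `α`, as `f` is its minimal polynomial.
    have hroots : (diskRoots Q : Set (AlgebraicClosure K⸨X⸩)) = (minpoly K⸨X⸩ α).rootSet _ := by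
      ext x
      rw [SetLike.mem_coe, Polynomial.mem_rootSet_of_ne (minpoly.ne_zero (hsep α hα).isIntegral),
        hmin hα, Polynomial.aeval_def, Polynomial.eval₂_map]
      exact hmem x
    rw [← SetLike.coe_sort_coe, hroots, Nat.card_eq_fintype_card,
      Polynomial.card_rootSet_eq_natDegree (hsep α hα) (IsAlgClosed.splits _), hmindeg hα]
  refine ⟨hcard, ?_⟩
  have hkcard : Nat.card (GaloisField p n) = q := by
    rw [GaloisField.card p n (by omega), hq]
  have hA : IsAffineSeries (laurentValuation K) (closureCoeff Q) q (valT K) :=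
    { two_le := hq2
      pos := valT_pos K
      lt_one := valT_lt_one K
      le_one := fun _ => laurentValuation_integersToClosure_le_one _
      eq_zero := fun k h2 hk => by rw [closureCoeff, hcmid h2 hk, map_zero]
      val_zero := by rw [closureCoeff, hc0]; exact laurentValuation_of_order_eq_one ha₀
      val_one := by rw [closureCoeff, hc1]; exact laurentValuation_of_order_eq_one ha₁
      val_q := by rw [closureCoeff, hcq]; exact laurentValuation_of_isUnit haqu
      val_det := by
        rw [closureCoeff, closureCoeff, closureCoeff, closureCoeff, hc0, hc1, hcq, hcq1,
          ← map_mul, ← map_mul, ← map_sub]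
        exact laurentValuation_of_order_eq_one hdet }
  obtain ⟨w, hw⟩ := haqu
  -- The common leading part of all the `(y - x) ^ (q - 1)`; `w` is `aq` as a unit.
  set c : PowerSeries K := -((a₁ * aq - a₀ * aq1) * ↑(w⁻¹ ^ 2)) with hcdef
  have hcord : c.order = 1 := by
    rw [hcdef, PowerSeries.order_neg, PowerSeries.order_mul, hdet,
      PowerSeries.order_zero_of_unit (Units.isUnit _), add_zero]
  have hcval : laurentValuation K (integersToClosure K c) = valT K :=
    laurentValuation_of_order_eq_one hcord
  have hcι : integersToClosure K c = -((closureCoeff Q 1 * closureCoeff Q q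
      - closureCoeff Q 0 * closureCoeff Q (q + 1)) / closureCoeff Q q ^ 2) := by
    have hw' : integersToClosure K (↑(w⁻¹ ^ 2) : PowerSeries K)
        = (integersToClosure K aq ^ 2)⁻¹ := by
      refine eq_inv_of_mul_eq_one_left ?_
      rw [← hw, ← map_pow, ← map_mul, ← Units.val_pow_eq_pow_val, ← Units.val_mul, ← mul_pow,
        inv_mul_cancel, one_pow, Units.val_one, map_one]
    simp only [closureCoeff, hc0, hc1, hcq, hcq1, hcdef, map_neg, map_mul, map_sub, hw',
      div_eq_mul_inv]
  obtain ⟨δ, hδ⟩ := IsAlgClosed.exists_pow_nat_eq (integersToClosure K c)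
    (show 0 < q - 1 by omega)
  have hcne : integersToClosure K c ≠ 0 := by
    intro h
    rw [h, map_zero] at hcval
    exact (valT_pos K).ne hcval
  have hδ0 : δ ≠ 0 := by
    rintro rfl
    rw [zero_pow (by omega)] at hδ
    exact hcne hδ.symm
  have : CharP (AlgebraicClosure K⸨X⸩) p :=
    charP_of_injective_algebraMap (algebraMap K (AlgebraicClosure K⸨X⸩)).injective p
  let _ : Algebra (ZMod p) K := ZMod.algebra K p
  -- `K` is algebraically closed, so `𝔽_q` embeds in the constants, which Galois fixes.
  let ψ : GaloisField p n →+* K⸨X⸩ :=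
    (algebraMap K K⸨X⸩).comp (IsAlgClosed.lift (R := ZMod p) (S := GaloisField p n) (M := K) :
      GaloisField p n →ₐ[ZMod p] K).toRingHom
  refine exists_equiv_map_range_eq_AGLOne ψ (v := laurentValuation K) laurentValuation_algEquiv
    (diskRoots Q) (hcard.trans hkcard.symm) ⟨α, hα⟩ hδ0 ?_ ?_ ?_ ?_
  · rw [hkcard]
    exact ⟨_, hδ⟩
  · intro x hx y hy hxy
    have h := hA.val_sub_pow_sub_lt hq (mem_diskRoots_iff.1 hx) (mem_diskRoots_iff.1 hy) hxy
    rw [← neg_neg (_ / _), ← hcι, ← sub_eq_add_neg] at h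
    rw [hkcard, div_pow, hδ, div_sub_one hcne, map_div₀, hcval, div_lt_one (valT_pos K)]
    exact h
  · rw [hkcard]
    exact (index_stabilizer_eq_natDegree_minpoly (hsep α hα)).trans (hmindeg hα)
  · rw [hkcard]
    refine index_stabilizer_of_pow_eq (by omega) ?_ hcord hδ
    -- In `K`, `q - 1` equals `-1`.
    rw [Nat.cast_sub (by omega), hq, Nat.cast_pow, CharP.cast_eq_zero, zero_pow (by omega)]
    simp
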